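/- Let $n\ge 1$. An input of MAXSUMOFANGLES consists of $2n$ distinct collinear points $c_1,\dots,c_{2n}$ in the Euclidean plane (cameras, in any order) and $n$ points $t_1,\dots,t_n$ in the same plane (targets), no target coinciding with a camera, such that for every target $t_k$ and every two distinct cameras $c_i,c_j$ the tracking angle $\angle c_i t_k c_j$ is at most $90^\circ$ (that is, no target lies strictly inside the Thales circle, the circle with diameter $c_ic_j$, of a camera pair). A feasible solution assigns two cameras to each target so that every camera is assigned to exactly one target. Its value is the sum, over all targets, of the angle at the target between its two cameras. The model of computation is the real RAM: a fixed finite program with conditionals and loops, working on finitely many arrays of natural numbers and of reals, which are indexed by computed natural numbers. Natural numbers are added, subtracted and compared; reals are added, subtracted, multiplied, divided and compared, and the arctangent of a real can be taken; natural numbers can be converted to reals, but not conversely; the only constants are natural numbers. Every operation, memory access and statement costs one unit. Theorem. There are a real-RAM program and a constant $K$ such that for every $n\ge1$, every real $\varepsilon$ with $0<\varepsilon<1$, and every input with $2n$ cameras and $n$ targets, the program, given $n$, $\varepsilon$ and the coordinates of the cameras and the targets, halts after at most $$K\cdot n^{K\log^2(n/\varepsilon)/\varepsilon^4}$$ steps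 and outputs a feasible solution whose value is at least $(1-\varepsilon)$ times the maximum value of a feasible solution. In particular, the program runs in quasi-polynomial time for every fixed $\varepsilon$. -/

import Mathlib

open scoped EuclideanGeometry

noncomputable section

/-! ## The real RAM

The machine has natural-number arrays and real-number arrays, all named by natural numbers and
initially zero outside the input. Array names in a program are constants, so a program uses finitely
many arrays; indices are computed at run time. Each evaluation of an operator, each memory
access, each constant, and each statement executed costs one unit. Natural numbers can be added,
subtracted and compared (multiplication is not a primitive). Reals admit the four field operations,
comparison and the arctangent; a real cannot be converted into an integer. Programs hold no real
constants besides images of natural numbers. -/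

namespace RealRAM

/-- Memory contents: `s.nat a i` and `s.real a i` are the cells of index `i` in the natural-number
array and in the real array of name `a`. -/
structure State where
  nat : ℕ → ℕ → ℕ
  real : ℕ → ℕ → ℝ

/-- The state `s` after writing `v` into the cell `i` of the natural-number array `a`. -/
def State.setNat (s : State) (a i v : ℕ) : State :=
  { s with nat := Function.update s.nat a (Function.update (s.nat a) i v) }

/-- The state `s` after writing `x` into the cell `i` of the real array `a`. -/
def State.setReal (s : State) (a i : ℕ) (x : ℝ) : State :=
  { s with real := Function.update s.real a (Function.update (s.real a) i x) }

/-- Natural-number expressions; `get a e` reads the cell `e` of the natural-number array `a`. -/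
inductive NatExpr where
  | const (k : ℕ)
  | get (a : ℕ) (e : NatExpr)
  | add (e f : NatExpr)
  | sub (e f : NatExpr)

/-- Value of an expression; subtraction is truncated at `0`. -/
def NatExpr.eval (s : State) : NatExpr → ℕ
  | const k => k
  | get a e => s.nat a (e.eval s)
  | add e f => e.eval s + f.eval s
  | sub e f => e.eval s - f.eval s

/-- Number of operations needed to evaluate an expression. -/
def NatExpr.cost : NatExpr → ℕ
  | const _ => 1
  | get _ e => e.cost + 1
  | add e f => e.cost + f.cost + 1
  | sub e f => e.cost + f.cost + 1

/-- Real expressions; `get a e` reads the cell `e` of the real array `a`. -/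
inductive RealExpr where
  | ofNat (e : NatExpr)
  | get (a : ℕ) (e : NatExpr)
  | add (e f : RealExpr)
  | sub (e f : RealExpr)
  | mul (e f : RealExpr)
  | div (e f : RealExpr)
  | arctan (e : RealExpr)

/-- Value of an expression; a division by `0` returns `0`. -/
def RealExpr.eval (s : State) : RealExpr → ℝ
  | ofNat e => (e.eval s : ℝ)
  | get a e => s.real a (e.eval s)
  | add e f => e.eval s + f.eval s
  | sub e f => e.eval s - f.eval s
  | mul e f => e.eval s * f.eval s
  | div e f => e.eval s / f.eval s
  | arctan e => Real.arctan (e.eval s)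

/-- Number of operations needed to evaluate an expression. -/
def RealExpr.cost : RealExpr → ℕ
  | ofNat e => e.cost + 1
  | get _ e => e.cost + 1
  | add e f => e.cost + f.cost + 1
  | sub e f => e.cost + f.cost + 1
  | mul e f => e.cost + f.cost + 1
  | div e f => e.cost + f.cost + 1
  | arctan e => e.cost + 1

/-- Tests that a program can branch on. -/
inductive Test where
  | natLE (e f : NatExpr)
  | realLE (e f : RealExpr)
  | not (b : Test)
  | and (b c : Test)

/-- Truth of a test in a state. -/
def Test.Holds (s : State) : Test → Prop
  | natLE e f => e.eval s ≤ f.eval s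
  | realLE e f => e.eval s ≤ f.eval s
  | not b => ¬ b.Holds s
  | and b c => b.Holds s ∧ c.Holds s

/-- Number of operations needed to evaluate a test. -/
def Test.cost : Test → ℕ
  | natLE e f => e.cost + f.cost + 1
  | realLE e f => e.cost + f.cost + 1
  | not b => b.cost + 1
  | and b c => b.cost + c.cost + 1

/-- Programs. `natSet a i e` writes the value of `e` into the cell `i` of the natural-number
array `a`, `realSet` does so for real arrays, and `loop b p` repeats `p` as long as `b` holds. -/
inductive Program where
  | skip
  | natSet (a : ℕ) (i e : NatExpr)
  | realSet (a : ℕ) (i : NatExpr) (e : RealExpr)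
  | seq (p q : Program)
  | ite (b : Test) (p q : Program)
  | loop (b : Test) (p : Program)

/-- `RunsIn p s τ s'`: started in the state `s`, the program `p` halts after exactly `τ` steps, in
the state `s'`. -/
inductive Program.RunsIn : Program → State → ℕ → State → Prop where
  | skip (s : State) : RunsIn skip s 1 s
  | natSet (a : ℕ) (i e : NatExpr) (s : State) :
      RunsIn (natSet a i e) s (i.cost + e.cost + 1) (s.setNat a (i.eval s) (e.eval s))
  | realSet (a : ℕ) (i : NatExpr) (e : RealExpr) (s : State) :
      RunsIn (realSet a i e) s (i.cost + e.cost + 1) (s.setReal a (i.eval s) (e.eval s))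
  | seq {p q : Program} {s s' s'' : State} {τ τ' : ℕ} :
      RunsIn p s τ s' → RunsIn q s' τ' s'' → RunsIn (seq p q) s (τ + τ') s''
  | iteTrue {b : Test} {p q : Program} {s s' : State} {τ : ℕ} :
      b.Holds s → RunsIn p s τ s' → RunsIn (ite b p q) s (b.cost + τ + 1) s'
  | iteFalse {b : Test} {p q : Program} {s s' : State} {τ : ℕ} :
      ¬ b.Holds s → RunsIn q s τ s' → RunsIn (ite b p q) s (b.cost + τ + 1) s'
  | loopStop {b : Test} {p : Program} {s : State} :
      ¬ b.Holds s → RunsIn (loop b p) s (b.cost + 1) s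
  | loopStep {b : Test} {p : Program} {s s' s'' : State} {τ τ' : ℕ} :
      b.Holds s → RunsIn p s τ s' → RunsIn (loop b p) s' τ' s'' →
        RunsIn (loop b p) s (b.cost + τ + τ' + 1) s''

end RealRAM

/-! ## Maximizing the sum of tracking angles -/

namespace MaxSumOfAngles

/-- An instance with `2 * n` cameras and `n` targets: distinct collinear cameras, in any order, and
targets on either side of the camera line such that every tracking angle is defined (no target
coincides with a camera) and at most a right angle. -/
structure Input (n : ℕ) where
  cam : Fin (2 * n) → EuclideanSpace ℝ (Fin 2)
  tgt : Fin n → EuclideanSpace ℝ (Fin 2)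
  cam_injective : Function.Injective cam
  cam_collinear : Collinear ℝ (Set.range cam)
  tgt_ne_cam : ∀ k i, tgt k ≠ cam i
  angle_le : ∀ k i j, i ≠ j → ∠ (cam i) (tgt k) (cam j) ≤ Real.pi / 2

/-- A feasible solution: target `k` is assigned the two cameras `cam k 0` and `cam k 1`, and each
camera is used exactly once. -/
structure Assignment (n : ℕ) where
  cam : Fin n → Fin 2 → Fin (2 * n)
  existsUnique : ∀ i : Fin (2 * n), ∃! p : Fin n × Fin 2, cam p.1 p.2 = i

/-- The sum of the tracking angles of an assignment. -/
def Input.sumOfAngles {n : ℕ} (I : Input n) (A : Assignment n) : ℝ :=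
  ∑ k : Fin n, ∠ (I.cam (A.cam k 0)) (I.tgt k) (I.cam (A.cam k 1))

/-- The initial memory: `n` is in the cell `0` of the natural-number array `0`, `ε` in the cell `0`
of the real array `0`, the coordinates of the cameras are in the real arrays `1` and `2`, those of
the targets in the real arrays `3` and `4`, and all other cells hold `0`. -/
def Input.initialState {n : ℕ} (I : Input n) (ε : ℝ) : RealRAM.State where
  nat a i := if a = 0 ∧ i = 0 then n else 0
  real a i :=
    match a with
    | 0 => if i = 0 then ε else 0
    | 1 => if h : i < 2 * n then I.cam ⟨i, h⟩ 0 else 0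
    | 2 => if h : i < 2 * n then I.cam ⟨i, h⟩ 1 else 0
    | 3 => if h : i < n then I.tgt ⟨i, h⟩ 0 else 0
    | 4 => if h : i < n then I.tgt ⟨i, h⟩ 1 else 0
    | _ => 0

/-- The final memory `s` holds the assignment `A`: the indices of the two cameras assigned to the
target `k` are in the cells `2 * k` and `2 * k + 1` of the natural-number array `1`. -/
def Assignment.IsOutput {n : ℕ} (A : Assignment n) (s : RealRAM.State) : Prop :=
  ∀ (k : Fin n) (j : Fin 2), s.nat 1 (2 * (k : ℕ) + (j : ℕ)) = (A.cam k j : ℕ)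

end MaxSumOfAngles

end

/-! Fix a target and measure the direction of each camera from the perpendicular to the camera line:
this is an arctangent, and the tracking angle of two cameras is the absolute difference of their
view angles (`Input.angle_eq`). Since |a - b| is the larger of a - b and b - a, one may split target
k into two slots, one paying minus the view angle of its camera, the other plus. An assignment of
cameras to slots never pays more than its sum of angles (`Input.sum_slotWeight_le`), and a suitable
ordering of each pair pays exactly that (`Input.exists_sum_slotWeight_eq`). The problem is thus a
linear assignment problem with 2n slots and 2n cameras.

The program solves it approximately by an auction: slots bid for cameras, each bid raises a price by
δ, and an outbid slot bids again. The final matching is within 2nδ of the optimum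
(`AuctionInv.sum_le`). Let D be the largest weight difference to camera 0. Some assignment has value
at least D, so δ = εD/(2n) gives a loss of at most ε times the optimum. An object receives O(n/ε)
bids and each bid takes O(n) steps, so the total is O(n³/ε) for n ≥ 2, well within the claimed bound
(`time_le`). -/

namespace RealRAM

/-! ### Rules for bounding running times and describing final states. -/

/-- Started in the state `s`, the program halts after at most `T` steps in a state satisfying `Q`. -/
def Program.HaltsWithin (p : Program) (s : State) (T : ℕ) (Q : State → Prop) : Prop :=
  ∃ (τ : ℕ) (s' : State), p.RunsIn s τ s' ∧ τ ≤ T ∧ Q s'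

theorem Program.HaltsWithin.mono {p : Program} {s : State} {T T' : ℕ} {Q Q' : State → Prop}
    (h : p.HaltsWithin s T Q) (hT : T ≤ T') (hQ : ∀ s', Q s' → Q' s') :
    p.HaltsWithin s T' Q' := by
  obtain ⟨τ, s', hr, hτ, hs⟩ := h
  exact ⟨τ, s', hr, hτ.trans hT, hQ _ hs⟩

theorem Program.HaltsWithin.seq {p q : Program} {s : State} {T T' : ℕ} {R Q : State → Prop}
    (hp : p.HaltsWithin s T R) (hq : ∀ s', R s' → q.HaltsWithin s' T' Q) :
    (Program.seq p q).HaltsWithin s (T + T') Q := by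
  obtain ⟨τ, s', hr, hτ, hs⟩ := hp
  obtain ⟨τ', s'', hr', hτ', hs'⟩ := hq _ hs
  exact ⟨τ + τ', s'', .seq hr hr', add_le_add hτ hτ', hs'⟩

/-- A loop whose invariant `Inv` counts the iterations and forces fewer than `M` of them. -/
theorem Program.HaltsWithin.loop {b : Test} {p : Program} {T M : ℕ} (Inv : ℕ → State → Prop)
    (hM : ∀ i s, Inv i s → b.Holds s → i < M)
    (hstep : ∀ i s, Inv i s → b.Holds s → p.HaltsWithin s T (Inv (i + 1)))
    {s : State} (h : Inv 0 s) :
    (Program.loop b p).HaltsWithin s (M * (b.cost + T + 1) + b.cost + 1)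
      (fun s' => (∃ i, Inv i s') ∧ ¬ b.Holds s') := by
  suffices H : ∀ r i s, Inv i s → M ≤ i + r →
      (Program.loop b p).HaltsWithin s (r * (b.cost + T + 1) + b.cost + 1)
        (fun s' => (∃ i, Inv i s') ∧ ¬ b.Holds s') from H M 0 s h (by omega)
  intro r
  induction r with
  | zero =>
    intro i s hi hr
    have hb : ¬ b.Holds s := fun hb => by have := hM i s hi hb; omega
    exact ⟨_, s, .loopStop hb, by omega, ⟨i, hi⟩, hb⟩
  | succ r ih =>
    intro i s hi hr
    by_cases hb : b.Holds s
    · obtain ⟨τ, s', hr', hτ, hs'⟩ := hstep i s hi hb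
      obtain ⟨τ', s'', hr'', hτ', hs''⟩ := ih (i + 1) s' hs' (by omega)
      exact ⟨_, s'', .loopStep hb hr' hr'', by rw [add_mul]; omega, hs''⟩
    · exact ⟨_, s, .loopStop hb, by omega, ⟨i, hi⟩, hb⟩

/-- Loop-free programs. -/
def Program.LoopFree : Program → Prop
  | skip => True
  | natSet _ _ _ => True
  | realSet _ _ _ => True
  | seq p q => p.LoopFree ∧ q.LoopFree
  | ite _ p q => p.LoopFree ∧ q.LoopFree
  | loop _ _ => False

/-- The state reached by a loop-free program. -/
noncomputable def Program.exec : Program → State → State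
  | skip, s => s
  | natSet a i e, s => s.setNat a (i.eval s) (e.eval s)
  | realSet a i e, s => s.setReal a (i.eval s) (e.eval s)
  | seq p q, s => q.exec (p.exec s)
  | ite b p q, s => open scoped Classical in if b.Holds s then p.exec s else q.exec s
  | loop _ _, s => s

/-- A bound on the running time of a loop-free program. -/
def Program.cost : Program → ℕ
  | skip => 1
  | natSet _ i e => i.cost + e.cost + 1
  | realSet _ i e => i.cost + e.cost + 1
  | seq p q => p.cost + q.cost
  | ite b p q => b.cost + p.cost + q.cost + 1
  | loop _ _ => 0

theorem Program.LoopFree.haltsWithin {p : Program} (hp : p.LoopFree) {s : State}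
    {Q : State → Prop} (hQ : Q (p.exec s)) : p.HaltsWithin s p.cost Q := by
  suffices H : ∃ τ, p.RunsIn s τ (p.exec s) ∧ τ ≤ p.cost by
    obtain ⟨τ, hr, hτ⟩ := H
    exact ⟨τ, _, hr, hτ, hQ⟩
  clear hQ
  induction p generalizing s with
  | skip => exact ⟨_, .skip s, le_rfl⟩
  | natSet a i e => exact ⟨_, .natSet a i e s, le_rfl⟩
  | realSet a i e => exact ⟨_, .realSet a i e s, le_rfl⟩
  | seq p q ihp ihq =>
    obtain ⟨τ, h, hτ⟩ := ihp hp.1 (s := s)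
    obtain ⟨τ', h', hτ'⟩ := ihq hp.2 (s := p.exec s)
    exact ⟨_, .seq h h', add_le_add hτ hτ'⟩
  | ite b p q ihp ihq =>
    by_cases hb : b.Holds s
    · obtain ⟨τ, h, hτ⟩ := ihp hp.1 (s := s)
      exact ⟨_, by simpa [Program.exec, hb] using .iteTrue hb h, by simp only [Program.cost]; omega⟩
    · obtain ⟨τ, h, hτ⟩ := ihq hp.2 (s := s)
      exact ⟨_, by simpa [Program.exec, hb] using .iteFalse hb h, by simp only [Program.cost]; omega⟩
  | loop => exact hp.elim

end RealRAM

/-! ### The auction as combinatorics, independent of the machine. -/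

namespace MaxSumOfAngles

/-- Invariant of the auction with bidders and objects `0, …, N - 1`, weights `w` and price
increment `δ`. The bidders `0, …, m` have entered and all of them but `cur` own an object: `mt p` is
the object of the bidder `p`, and `ow j` is `0` if `j` is free and `p + 1` if `p` owns `j`. The object
`j` has received `b j` bids, at most `B` of them, and there have been `t` bids altogether. -/
structure AuctionInv (N B : ℕ) (w : ℕ → ℕ → ℝ) (δ : ℝ) (m cur : ℕ) (mt ow b : ℕ → ℕ) (t : ℕ) :
    Prop where
  cur_le : cur ≤ m
  le_card : m ≤ N
  cur_lt : m < N → cur < N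
  cur_eq : m = N → cur = N
  sum_eq : ∑ j ∈ Finset.range N, b j = t
  bids_le : ∀ j < N, b j ≤ B
  free : ∀ j < N, ow j = 0 → b j = 0
  owned : ∀ j < N, ∀ p, ow j = p + 1 → p ≤ m ∧ p ≠ cur ∧ mt p = j
  matched : ∀ p < N, p ≤ m → p ≠ cur → mt p < N ∧ ow (mt p) = p + 1
  slack : ∀ p < N, p ≤ m → p ≠ cur → ∀ j < N,
    w p j - b j * δ ≤ w p (mt p) - b (mt p) * δ + δ

/-- Pigeonhole: if all N objects were owned, their owners would lie among the m < N bidders other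
than `cur`, yet a bidder owns only the object `mt` names. -/
theorem AuctionInv.exists_free {N B : ℕ} {w : ℕ → ℕ → ℝ} {δ : ℝ} {m cur : ℕ} {mt ow b : ℕ → ℕ}
    {t : ℕ} (h : AuctionInv N B w δ m cur mt ow b t) (hm : m < N) : ∃ j < N, ow j = 0 := by
  by_contra! hne
  have hmaps : ∀ j ∈ Finset.range N, ow j - 1 ∈ (Finset.range (m + 1)).erase cur := by
    intro j hj
    rw [Finset.mem_range] at hj
    have := h.owned j hj (ow j - 1) (by have := hne j hj; omega)
    rw [Finset.mem_erase, Finset.mem_range]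
    exact ⟨this.2.1, by omega⟩
  have hcard : ((Finset.range (m + 1)).erase cur).card < (Finset.range N).card := by
    rw [Finset.card_erase_of_mem (by rw [Finset.mem_range]; have := h.cur_le; omega)]
    simpa using hm
  obtain ⟨i, hi, j, hj, hij, heq⟩ := Finset.exists_ne_map_eq_of_card_lt_of_maps_to hcard hmaps
  rw [Finset.mem_range] at hi hj
  have h1 := (h.owned i hi (ow i - 1) (by have := hne i hi; omega)).2.2
  have h2 := (h.owned j hj (ow j - 1) (by have := hne j hj; omega)).2.2
  exact hij (h1.symm.trans ((congrArg mt heq).trans h2))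

/-- A free object still has price 0, and `cur` prefers `j` to it, so the price of `j` is below `B *
δ` and one more bid is allowed. The new owner found `j` best before its price rose by δ, hence slack
δ. The other remaining owners keep their slack: their own price is unchanged and the others only
rise. -/
theorem AuctionInv.step {N B : ℕ} {w : ℕ → ℕ → ℝ} {δ : ℝ} {m cur : ℕ} {mt ow b : ℕ → ℕ} {t : ℕ}
    (h : AuctionInv N B w δ m cur mt ow b t) (hm : m < N) (hδ : 0 < δ)
    (hB : ∀ p < N, ∀ i < N, ∀ j < N, w p i - w p j < B * δ) {j : ℕ} (hj : j < N)
    (hbest : ∀ i < N, w cur i - b i * δ ≤ w cur j - b j * δ) :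
    AuctionInv N B w δ (if ow j = 0 then m + 1 else m) (if ow j = 0 then m + 1 else ow j - 1)
      (Function.update mt cur j) (Function.update ow j (cur + 1))
      (Function.update b j (b j + 1)) (t + 1) := by
  have hcur := h.cur_lt hm
  have hcm := h.cur_le
  have hbj : b j + 1 ≤ B := by
    obtain ⟨i, hi, hfree⟩ := h.exists_free hm
    have h1 := hbest i hi
    have h2 := hB cur hcur j hj i hi
    rw [h.free i hi hfree] at h1
    have : (b j : ℝ) * δ < B * δ := by push_cast at h1; linarith
    exact_mod_cast lt_of_mul_lt_mul_right this hδ.le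
  have hmono : ∀ i, (b i : ℝ) * δ ≤ (Function.update b j (b j + 1) i : ℕ) * δ := by
    intro i
    refine mul_le_mul_of_nonneg_right ?_ hδ.le
    rcases eq_or_ne i j with rfl | hi
    · simp
    · simp [hi]
  have hold : ∀ p, p ≠ cur → p < N → p ≤ (if ow j = 0 then m + 1 else m) →
      p ≠ (if ow j = 0 then m + 1 else ow j - 1) → p ≤ m ∧ mt p ≠ j := by
    intro p hp hpN hpm hpc
    split_ifs at hpm hpc with ho
    · refine ⟨by omega, fun hpj => ?_⟩
      have := (h.matched p hpN (by omega) hp).2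
      rw [hpj] at this; omega
    · refine ⟨by omega, fun hpj => ?_⟩
      have := (h.matched p hpN (by omega) hp).2
      rw [hpj] at this; omega
  refine ⟨?_, ?_, ?_, ?_, ?_, ?_, ?_, ?_, ?_, ?_⟩
  · split_ifs with ho
    · exact le_rfl
    · exact (h.owned j hj (ow j - 1) (by omega)).1
  · split_ifs <;> omega
  · split_ifs with ho
    · exact id
    · intro _; have := (h.owned j hj (ow j - 1) (by omega)).1; omega
  · split_ifs with ho
    · exact id
    · omega
  · rw [Finset.sum_update_of_mem (Finset.mem_range.2 hj), ← h.sum_eq,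
      Finset.sdiff_singleton_eq_erase,
      ← Finset.add_sum_erase _ b (Finset.mem_range.2 hj)]
    omega
  · intro i hi
    rcases eq_or_ne i j with rfl | hij
    · simpa using hbj
    · simpa [hij] using h.bids_le i hi
  · intro i hi
    rcases eq_or_ne i j with rfl | hij
    · simp
    · simpa [hij] using h.free i hi
  · intro i hi p hp
    rcases eq_or_ne i j with rfl | hij
    · have hpc : p = cur := by simpa using hp.symm
      subst hpc
      refine ⟨?_, ?_, by simp⟩
      · split_ifs <;> omega
      · split_ifs with ho
        · omega
        · have := (h.owned i hi (ow i - 1) (by omega)).2.1; omega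
    · rw [Function.update_of_ne hij] at hp
      obtain ⟨h1, h2, h3⟩ := h.owned i hi p hp
      refine ⟨?_, ?_, by rwa [Function.update_of_ne h2]⟩
      · split_ifs <;> omega
      · split_ifs with ho
        · omega
        · intro hpo
          have := (h.owned j hj p (by omega)).2.2
          omega
  · intro p hpN hpm hpc
    rcases eq_or_ne p cur with rfl | hp
    · simpa using hj
    · obtain ⟨h1, h2⟩ := hold p hp hpN hpm hpc
      rw [Function.update_of_ne hp, Function.update_of_ne h2]
      exact h.matched p hpN h1 hp
  · intro p hpN hpm hpc i hi
    rcases eq_or_ne p cur with rfl | hp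
    · have h1 := hbest i hi
      have h2 := hmono i
      simp only [Function.update_self]
      push_cast
      linarith
    · obtain ⟨h1, h2⟩ := hold p hp hpN hpm hpc
      have h3 := h.slack p hpN h1 hp i hi
      have h4 := hmono i
      rw [Function.update_of_ne hp, Function.update_of_ne h2]
      linarith

/-- The final matching is a bijection. -/
theorem AuctionInv.injOn {N B : ℕ} {w : ℕ → ℕ → ℝ} {δ : ℝ} {mt ow b : ℕ → ℕ}
    {t : ℕ} (h : AuctionInv N B w δ N N mt ow b t) :
    (∀ p < N, mt p < N) ∧ Set.InjOn mt (Set.Iio N) := by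
  refine ⟨fun p hp => (h.matched p hp hp.le hp.ne).1, fun p hp q hq hpq => ?_⟩
  have h1 := (h.matched p hp (le_of_lt hp) (ne_of_lt hp)).2
  have h2 := (h.matched q hq (le_of_lt hq) (ne_of_lt hq)).2
  rw [hpq] at h1
  omega

theorem sum_range_comp_of_injOn {N : ℕ} {g : ℕ → ℕ} (hg : ∀ p < N, g p < N)
    (hinj : Set.InjOn g (Set.Iio N)) (f : ℕ → ℝ) :
    ∑ p ∈ Finset.range N, f (g p) = ∑ p ∈ Finset.range N, f p := by
  have hinj' : Set.InjOn g (Finset.range N : Finset ℕ) := by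
    simpa [Finset.coe_range] using hinj
  have himg : (Finset.range N).image g = Finset.range N := by
    refine Finset.eq_of_subset_of_card_le ?_ (Finset.card_image_of_injOn hinj').ge
    intro x hx
    obtain ⟨p, hp, rfl⟩ := Finset.mem_image.1 hx
    exact Finset.mem_range.2 (hg p (Finset.mem_range.1 hp))
  conv_rhs => rw [← himg, Finset.sum_image hinj']

/-- The final matching loses at most `δ` per bidder. -/
theorem AuctionInv.sum_le {N B : ℕ} {w : ℕ → ℕ → ℝ} {δ : ℝ} {mt ow b : ℕ → ℕ}
    {t : ℕ} (h : AuctionInv N B w δ N N mt ow b t) {g : ℕ → ℕ} (hg : ∀ p < N, g p < N)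
    (hinj : Set.InjOn g (Set.Iio N)) :
    ∑ p ∈ Finset.range N, w p (g p) ≤ ∑ p ∈ Finset.range N, w p (mt p) + N * δ := by
  have key : ∑ p ∈ Finset.range N, (w p (g p) - b (g p) * δ) ≤
      ∑ p ∈ Finset.range N, (w p (mt p) - b (mt p) * δ + δ) := by
    refine Finset.sum_le_sum fun p hp => ?_
    have hp := Finset.mem_range.1 hp
    exact h.slack p hp hp.le hp.ne _ (hg p hp)
  -- Both matchings use every object once, so the total prices on the two sides cancel.
  rw [Finset.sum_sub_distrib, Finset.sum_add_distrib, Finset.sum_sub_distrib,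
    sum_range_comp_of_injOn hg hinj (fun j => b j * δ),
    sum_range_comp_of_injOn h.injOn.1 h.injOn.2 (fun j => b j * δ)] at key
  simp only [Finset.sum_const, Finset.card_range, nsmul_eq_mul] at key
  linarith

end MaxSumOfAngles

/-! ### The program, its memory layout and its first subroutines. -/

noncomputable section
namespace MaxSumOfAngles
open RealRAM

/-- The signed angle under which the target `(tx k, ty k)` sees the segment from its foot on the
camera line to the camera `(cx c, cy c)`, up to an additive constant and a sign depending only
on `k`. -/
def viewAngle (cx cy tx ty : ℕ → ℝ) (k c : ℕ) : ℝ :=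
  Real.arctan
    (((cx c - tx k) * (cx 1 - cx 0) + (cy c - ty k) * (cy 1 - cy 0)) /
      ((cx c - tx k) * (cy 1 - cy 0) - (cy c - ty k) * (cx 1 - cx 0)))

/-- The weight of the camera `c` in the slot `p` of the target `p / 2`: its view angle, with a sign
given by the parity of `p`. -/
def slotWeight (cx cy tx ty : ℕ → ℝ) (p c : ℕ) : ℝ :=
  (2 * ((p % 2 : ℕ) : ℝ) - 1) * viewAngle cx cy tx ty (p / 2) c

namespace Auction

/-- Memory layout: natural arrays 1 and 2 hold `mt` and `ow`, array 3 the scalars, arrays 4 and 5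
the tables of `p / 2` and `p % 2`, which are not machine operations. Real array 5 holds the prices,
real array 6 the range and the increment. As array 1 is also the output array, the final matching
needs no copying. -/
abbrev nE : NatExpr := .get 0 (.const 0)
abbrev slotsE : NatExpr := .add nE nE
abbrev mE : NatExpr := .get 3 (.const 0)
abbrev curE : NatExpr := .get 3 (.const 1)
abbrev idxE : NatExpr := .get 3 (.const 2)
abbrev bestE : NatExpr := .get 3 (.const 3)
abbrev oldE : NatExpr := .get 3 (.const 4)
abbrev rangeE : RealExpr := .get 6 (.const 0)
abbrev incE : RealExpr := .get 6 (.const 1)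

/-- The weight of the camera `c` in the slot `p`. -/
def weightE (p c : NatExpr) : RealExpr :=
  let dx : RealExpr := .sub (.get 1 c) (.get 3 (.get 4 p))
  let dy : RealExpr := .sub (.get 2 c) (.get 4 (.get 4 p))
  let ux : RealExpr := .sub (.get 1 (.const 1)) (.get 1 (.const 0))
  let uy : RealExpr := .sub (.get 2 (.const 1)) (.get 2 (.const 0))
  .mul (.sub (.mul (.ofNat (.const 2)) (.ofNat (.get 5 p))) (.ofNat (.const 1)))
    (.arctan (.div (.add (.mul dx ux) (.mul dy uy)) (.sub (.mul dx uy) (.mul dy ux))))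

/-- Fills the arrays `4` and `5` with `p / 2` and `p % 2`. -/
def setupBody : Program :=
  .seq (.natSet 4 (.add idxE idxE) idxE) <|
  .seq (.natSet 4 (.add (.add idxE idxE) (.const 1)) idxE) <|
  .seq (.natSet 5 (.add (.add idxE idxE) (.const 1)) (.const 1)) <|
  .natSet 3 (.const 2) (.add idxE (.const 1))

def setup : Program := .loop (.not (.natLE nE idxE)) setupBody

def scanBody : Program :=
  .seq
    (.ite (.realLE (.sub (weightE curE bestE) (.get 5 bestE)) (.sub (weightE curE idxE) (.get 5 idxE)))
      (.natSet 3 (.const 3) idxE) .skip)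
    (.natSet 3 (.const 2) (.add idxE (.const 1)))

/-- Finds a camera of greatest weight minus price for the slot `cur`. -/
def scan : Program :=
  .seq (.seq (.natSet 3 (.const 2) (.const 0)) (.natSet 3 (.const 3) (.const 0)))
    (.loop (.not (.natLE slotsE idxE)) scanBody)

def measureUpdate : Program :=
  .seq
    (.ite (.realLE rangeE (.sub (weightE curE bestE) (weightE curE (.const 0))))
      (.realSet 6 (.const 0) (.sub (weightE curE bestE) (weightE curE (.const 0)))) .skip)
    (.natSet 3 (.const 1) (.add curE (.const 1)))

/-- Computes the largest difference between the weights of a camera and of the camera `0`. -/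
def measure : Program := .loop (.not (.natLE slotsE curE)) (.seq scan measureUpdate)

/-- If the range is 0 all angles vanish and any assignment is optimal; the increment 1 only keeps
the bidding finite. -/
def start : Program :=
  .seq
    (.ite (.realLE rangeE (.ofNat (.const 0))) (.realSet 6 (.const 1) (.ofNat (.const 1)))
      (.realSet 6 (.const 1) (.div (.mul (.get 0 (.const 0)) rangeE) (.ofNat slotsE))))
    (.natSet 3 (.const 1) (.const 0))

/-- One bid. The previous owner, saved before being overwritten, bids next; if the object was free,
a new bidder enters instead. -/
def assign : Program :=
  .seq (.realSet 5 bestE (.add (.get 5 bestE) incE)) <|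
  .seq (.natSet 1 curE bestE) <|
  .seq (.natSet 3 (.const 4) (.get 2 bestE)) <|
  .seq (.natSet 2 bestE (.add curE (.const 1))) <|
  .ite (.natLE oldE (.const 0))
    (.seq (.natSet 3 (.const 0) (.add mE (.const 1))) (.natSet 3 (.const 1) mE))
    (.natSet 3 (.const 1) (.sub oldE (.const 1)))

def bidding : Program := .loop (.not (.natLE slotsE mE)) (.seq scan assign)

/-- At n = 1 the allowed time is a constant independent of ε, so the auction is bypassed. Cell 0 of
the output already holds 0. -/
def main : Program :=
  .ite (.natLE nE (.const 1)) (.natSet 1 (.const 1) (.const 1))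
    (.seq setup (.seq measure (.seq start bidding)))

variable {n : ℕ} {ε : ℝ} {cx cy tx ty : ℕ → ℝ}

/-- The cells that hold the input are intact. -/
structure HasInput (n : ℕ) (ε : ℝ) (cx cy tx ty : ℕ → ℝ) (s : State) : Prop where
  n_eq : s.nat 0 0 = n
  eps_eq : s.real 0 0 = ε
  cx_eq : s.real 1 = cx
  cy_eq : s.real 2 = cy
  tx_eq : s.real 3 = tx
  ty_eq : s.real 4 = ty

/-- The input is intact and the setup has been carried out. -/
structure Ready (n : ℕ) (ε : ℝ) (cx cy tx ty : ℕ → ℝ) (s : State) : Prop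
    extends HasInput n ε cx cy tx ty s where
  half : ∀ p < 2 * n, s.nat 4 p = p / 2
  parity : ∀ p < 2 * n, s.nat 5 p = p % 2

theorem Ready.congr {s s' : State} (h : Ready n ε cx cy tx ty s)
    (hn : ∀ a, a = 0 ∨ a = 4 ∨ a = 5 → s'.nat a = s.nat a)
    (hr : ∀ a ≤ 4, s'.real a = s.real a) : Ready n ε cx cy tx ty s' where
  n_eq := by rw [hn 0 (by simp), h.n_eq]
  eps_eq := by rw [hr 0 (by simp), h.eps_eq]
  cx_eq := by rw [hr 1 (by simp), h.cx_eq]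
  cy_eq := by rw [hr 2 (by simp), h.cy_eq]
  tx_eq := by rw [hr 3 (by simp), h.tx_eq]
  ty_eq := by rw [hr 4 (by simp), h.ty_eq]
  half := by rw [hn 4 (by simp)]; exact h.half
  parity := by rw [hn 5 (by simp)]; exact h.parity

theorem Ready.eval_weightE {s : State} (h : Ready n ε cx cy tx ty s) {p : NatExpr}
    (c : NatExpr) (hp : p.eval s < 2 * n) :
    (weightE p c).eval s = slotWeight cx cy tx ty (p.eval s) (c.eval s) := by
  simp [weightE, slotWeight, viewAngle, RealExpr.eval, NatExpr.eval, h.cx_eq, h.cy_eq, h.tx_eq,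
    h.ty_eq, h.half _ hp, h.parity _ hp]

theorem setup_halts : ∃ C : ℕ, ∀ (n : ℕ) (ε : ℝ) (cx cy tx ty : ℕ → ℝ) (s : State), 1 ≤ n →
    HasInput n ε cx cy tx ty s → s.nat 3 2 = 0 → s.nat 5 = 0 →
    setup.HaltsWithin s (C * n) (fun s' => Ready n ε cx cy tx ty s' ∧ s'.real = s.real ∧
      (∀ a < 3, s'.nat a = s.nat a) ∧ ∀ i ≠ 2, s'.nat 3 i = s.nat 3 i) := by
  set b : Test := .not (.natLE nE idxE) with hb
  refine ⟨(b.cost + setupBody.cost + 1) + (b.cost + 1), fun n ε cx cy tx ty s hn hs h2 h5 => ?_⟩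
  -- The last clause is needed because the even cells of array 5 are never written: they rely on
  -- being 0 initially.
  let Inv : ℕ → State → Prop := fun i s' => s'.nat 3 2 = i ∧ i ≤ n ∧ s'.real = s.real ∧
    (∀ a < 3, s'.nat a = s.nat a) ∧ (∀ i ≠ 2, s'.nat 3 i = s.nat 3 i) ∧
    (∀ p < 2 * i, s'.nat 4 p = p / 2) ∧ (∀ p < 2 * i, s'.nat 5 p = p % 2) ∧
    ∀ p, 2 * i ≤ p → s'.nat 5 p = 0
  have hbI : ∀ i s', Inv i s' → (b.Holds s' ↔ i < n) := by
    rintro i s' ⟨h1, -, -, h4, -⟩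
    simp [hb, Test.Holds, NatExpr.eval, h1, h4 0, hs.n_eq]
  refine (Program.HaltsWithin.loop (T := setupBody.cost) (M := n) Inv ?_ ?_ ?_).mono ?_ ?_
  · exact fun i s' hi hb' => (hbI i s' hi).1 hb'
  · intro i s' hi hb'
    have hin := (hbI i s' hi).1 hb'
    obtain ⟨h1, -, hr, ha, h3, h4, h5, h6⟩ := hi
    refine Program.LoopFree.haltsWithin (by simp [setupBody, Program.LoopFree]) ?_
    simp only [setupBody, Program.exec, NatExpr.eval, State.setNat, Inv]
    refine ⟨by simp [h1], by omega, hr, ?_, ?_, ?_, ?_, ?_⟩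
    · intro a ha3
      simp [show a ≠ 3 by omega, show a ≠ 4 by omega, show a ≠ 5 by omega, ha a ha3]
    · intro i hi
      simp [hi, h3 i hi]
    · intro p hp
      simp only [Function.update_apply, h1]
      simp only [show (4 : ℕ) ≠ 3 by omega, show (4 : ℕ) ≠ 5 by omega, if_false, if_true,
        show (3 : ℕ) ≠ 4 by omega, Function.update_apply, h1]
      split_ifs
      · omega
      · omega
      · exact h4 p (by omega)
    · intro p hp
      simp [Function.update_apply, h1]
      split_ifs
      · omega
      · rcases lt_or_ge p (2 * i) with h | h
        · exact h5 p h
        · rw [h6 p h]; omega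
    · intro p hp
      simp [Function.update_apply, h1]
      rw [if_neg (by omega)]
      exact h6 p (by omega)
  · exact ⟨h2, by omega, rfl, fun _ _ => rfl, fun _ _ => rfl, by simp, by simp, by simp [h5]⟩
  · nlinarith
  · rintro s' ⟨⟨i, hi⟩, hb'⟩
    have hin := mt (hbI i s' hi).2 hb'
    obtain ⟨-, h0, hr, ha, h3, h4, h5, -⟩ := hi
    obtain rfl : i = n := by omega
    refine ⟨⟨⟨?_, ?_, ?_, ?_, ?_, ?_⟩, h4, h5⟩, hr, ha, h3⟩
    · rw [ha 0 (by omega), hs.n_eq]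
    · rw [hr, hs.eps_eq]
    · rw [hr, hs.cx_eq]
    · rw [hr, hs.cy_eq]
    · rw [hr, hs.tx_eq]
    · rw [hr, hs.ty_eq]

theorem scan_halts : ∃ C : ℕ, ∀ (n : ℕ) (ε : ℝ) (cx cy tx ty : ℕ → ℝ) (s : State), 1 ≤ n →
    Ready n ε cx cy tx ty s → s.nat 3 1 < 2 * n →
    scan.HaltsWithin s (C * n) (fun s' => s'.real = s.real ∧
      (∀ a ≠ 3, s'.nat a = s.nat a) ∧ (∀ i, i ≠ 2 → i ≠ 3 → s'.nat 3 i = s.nat 3 i) ∧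
      s'.nat 3 3 < 2 * n ∧
      ∀ i < 2 * n, slotWeight cx cy tx ty (s.nat 3 1) i - s.real 5 i ≤
        slotWeight cx cy tx ty (s.nat 3 1) (s'.nat 3 3) - s.real 5 (s'.nat 3 3)) := by
  set b : Test := .not (.natLE slotsE idxE) with hb
  refine ⟨((Program.seq (.natSet 3 (.const 2) (.const 0)) (.natSet 3 (.const 3) (.const 0))).cost) +
    2 * (b.cost + scanBody.cost + 1) + (b.cost + 1), fun n ε cx cy tx ty s hn hs hcur => ?_⟩
  set w := slotWeight cx cy tx ty (s.nat 3 1) with hw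
  let Inv : ℕ → State → Prop := fun i s' => s'.nat 3 2 = i ∧ i ≤ 2 * n ∧ s'.real = s.real ∧
    (∀ a ≠ 3, s'.nat a = s.nat a) ∧ (∀ i, i ≠ 2 → i ≠ 3 → s'.nat 3 i = s.nat 3 i) ∧
    s'.nat 3 3 < 2 * n ∧
    ∀ j < i, w j - s.real 5 j ≤ w (s'.nat 3 3) - s.real 5 (s'.nat 3 3)
  have hbI : ∀ i s', Inv i s' → (b.Holds s' ↔ i < 2 * n) := by
    rintro i s' ⟨h1, -, -, h4, -⟩
    simp [hb, Test.Holds, NatExpr.eval, h1, h4 0, hs.n_eq, two_mul]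
  refine (Program.HaltsWithin.seq (R := Inv 0)
    (Program.LoopFree.haltsWithin (by simp [Program.LoopFree]) ?_) (fun s₁ hs₁ =>
    Program.HaltsWithin.loop (T := scanBody.cost) (M := 2 * n) Inv ?_ ?_ hs₁)).mono ?_ ?_
  · simp only [Program.exec, NatExpr.eval, State.setNat, Inv]
    refine ⟨by simp, by omega, trivial, fun a ha => by simp [ha], fun i h2 h3 => by simp [h2, h3],
      by simp; omega, by simp⟩
  · exact fun i s' hi hb' => (hbI i s' hi).1 hb'
  · intro i s' hi hb'
    have hin := (hbI i s' hi).1 hb'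
    obtain ⟨h1, -, hr, ha, h3, hbest, hmax⟩ := hi
    have hs' : Ready n ε cx cy tx ty s' := hs.congr
      (fun a h => ha a (by omega)) (fun a _ => by rw [hr])
    have hc : s'.nat 3 1 = s.nat 3 1 := h3 1 (by omega) (by omega)
    have hc' : curE.eval s' < 2 * n := by simp only [NatExpr.eval, hc]; exact hcur
    refine Program.LoopFree.haltsWithin (by simp [scanBody, Program.LoopFree]) ?_
    simp only [scanBody, Program.exec, Test.Holds, RealExpr.eval, hs'.eval_weightE _ hc']
    simp only [NatExpr.eval, hc, h1, hr, ← hw]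
    split_ifs with hle
    · simp only [State.setNat, Inv]
      refine ⟨by simp [h1], by omega, hr, fun a h => by simp [h, ha a h], fun i h h' => ?_,
        by simp [hin], ?_⟩
      · simp [h, h', h3 i h h']
      · intro j hj
        simp only [Function.update_self, ne_eq, show (3 : ℕ) ≠ 2 by omega, not_false_eq_true,
          Function.update_of_ne]
        rcases Nat.lt_succ_iff_lt_or_eq.1 hj with hj | rfl
        · exact (hmax j hj).trans hle
        · exact le_rfl
    · simp only [State.setNat, Inv]
      refine ⟨by simp [h1], by omega, hr, fun a h => by simp [h, ha a h], fun i h h' => ?_,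
        by simp [hbest], ?_⟩
      · simp [h, h3 i h h']
      · intro j hj
        simp only [Function.update_self, ne_eq, show (3 : ℕ) ≠ 2 by omega, not_false_eq_true,
          Function.update_of_ne]
        rcases Nat.lt_succ_iff_lt_or_eq.1 hj with hj | rfl
        · exact hmax j hj
        · exact (not_le.1 hle).le
  · nlinarith
  · rintro s' ⟨⟨i, hi⟩, hb'⟩
    have hin := mt (hbI i s' hi).2 hb'
    obtain ⟨-, h0, hr, ha, h3, h4, h5⟩ := hi
    obtain rfl : i = 2 * n := by omega
    exact ⟨hr, ha, h3, h4, h5⟩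

end Auction
end MaxSumOfAngles
end

/-! ### Measuring the range, choosing the increment, and the bidding loop. -/

noncomputable section
namespace MaxSumOfAngles
open RealRAM
namespace Auction

/-- `D` is the largest difference between the weights of a camera and of the camera `0`. -/
structure IsRange (N : ℕ) (w : ℕ → ℕ → ℝ) (D : ℝ) : Prop where
  nonneg : 0 ≤ D
  le : ∀ p < N, ∀ c < N, w p c - w p 0 ≤ D
  attained : D = 0 ∨ ∃ p < N, ∃ c < N, D = w p c - w p 0

theorem measure_halts : ∃ C : ℕ, ∀ (n : ℕ) (ε : ℝ) (cx cy tx ty : ℕ → ℝ) (s : State), 1 ≤ n →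
    Ready n ε cx cy tx ty s → s.nat 3 1 = 0 → s.real 5 = 0 → s.real 6 0 = 0 →
    measure.HaltsWithin s (C * n * n) (fun s' => (∀ a ≠ 6, s'.real a = s.real a) ∧
      (∀ a ≠ 3, s'.nat a = s.nat a) ∧ s'.nat 3 0 = s.nat 3 0 ∧
      IsRange (2 * n) (slotWeight cx cy tx ty) (s'.real 6 0)) := by
  obtain ⟨C, hC⟩ := scan_halts
  set b : Test := .not (.natLE slotsE curE) with hb
  refine ⟨2 * (b.cost + (C + measureUpdate.cost) + 1) + (b.cost + 1),
    fun n ε cx cy tx ty s hn hs hcur h5 h6 => ?_⟩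
  set w := slotWeight cx cy tx ty with hw
  let Inv : ℕ → State → Prop := fun i s' => s'.nat 3 1 = i ∧ i ≤ 2 * n ∧
    (∀ a ≠ 6, s'.real a = s.real a) ∧ (∀ a ≠ 3, s'.nat a = s.nat a) ∧ s'.nat 3 0 = s.nat 3 0 ∧
    0 ≤ s'.real 6 0 ∧ (∀ p < i, ∀ c < 2 * n, w p c - w p 0 ≤ s'.real 6 0) ∧
    (s'.real 6 0 = 0 ∨ ∃ p < 2 * n, ∃ c < 2 * n, s'.real 6 0 = w p c - w p 0)
  have hbI : ∀ i s', Inv i s' → (b.Holds s' ↔ i < 2 * n) := by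
    rintro i s' ⟨h1, -, -, h4, -⟩
    simp [hb, Test.Holds, NatExpr.eval, h1, h4 0, hs.n_eq, two_mul]
  refine (Program.HaltsWithin.loop (T := C * n + measureUpdate.cost) (M := 2 * n) Inv
    ?_ ?_ ?_).mono ?_ ?_
  · exact fun i s' hi hb' => (hbI i s' hi).1 hb'
  · intro i s' hi hb'
    have hin := (hbI i s' hi).1 hb'
    obtain ⟨h1, -, hr, ha, h30, hD, hle, hatt⟩ := hi
    have hs' : Ready n ε cx cy tx ty s' := hs.congr
      (fun a h => ha a (by omega)) (fun a _ => hr a (by omega))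
    refine (hC n ε cx cy tx ty s' hn hs' (by omega)).seq ?_
    rintro t ⟨tr, ta, t3, tb, tmax⟩
    have ht : Ready n ε cx cy tx ty t := hs'.congr
      (fun a h => ta a (by omega)) (fun a _ => by rw [tr])
    have hc : t.nat 3 1 = i := by rw [t3 1 (by omega) (by omega), h1]
    have hc' : curE.eval t < 2 * n := by simp only [NatExpr.eval, hc]; exact hin
    -- All prices are still 0, so the scan maximizes the weight itself.
    simp only [h1, hr 5 (by omega), h5, Pi.zero_apply, sub_zero, ← hw] at tmax
    refine Program.LoopFree.haltsWithin (by simp [measureUpdate, Program.LoopFree]) ?_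
    simp only [measureUpdate, Program.exec, Test.Holds, RealExpr.eval, ht.eval_weightE _ hc']
    simp only [NatExpr.eval, hc, tr, ← hw]
    split_ifs with hcmp
    · simp only [State.setNat, State.setReal, Inv]
      refine ⟨by simp [hc], by omega, fun a h => by simp [h, tr, hr a h],
        fun a h => by simp [h, ta a h, ha a h],
        by simp [t3 0, h30], by simp [hD.trans hcmp], ?_, ?_⟩
      · intro p hp c hcn
        simp only [Function.update_self]
        rcases Nat.lt_succ_iff_lt_or_eq.1 hp with hp | rfl
        · exact (hle p hp c hcn).trans hcmp
        · linarith [tmax c hcn]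
      · simp only [Function.update_self]
        exact Or.inr ⟨i, hin, _, tb, rfl⟩
    · simp only [State.setNat, Inv]
      refine ⟨by simp [hc], by omega, fun a h => by simp [tr, hr a h],
        fun a h => by simp [h, ta a h, ha a h],
        by simp [t3 0, h30], by rw [tr]; exact hD, ?_, by rw [tr]; exact hatt⟩
      intro p hp c hcn
      rw [tr]
      rcases Nat.lt_succ_iff_lt_or_eq.1 hp with hp | rfl
      · exact hle p hp c hcn
      · linarith [tmax c hcn]
  · exact ⟨hcur, by omega, fun _ _ => rfl, fun _ _ => rfl, rfl, h6.ge, by simp, Or.inl h6⟩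
  · have : C * n + measureUpdate.cost ≤ (C + measureUpdate.cost) * n := by nlinarith
    calc _ ≤ 2 * n * (b.cost * n + (C + measureUpdate.cost) * n + n) + (b.cost + 1) * (n * n) := by
          have h1 : b.cost ≤ b.cost * n := Nat.le_mul_of_pos_right _ hn
          have h2 : 1 ≤ n * n := Nat.mul_pos hn hn
          have h3 : b.cost + 1 ≤ (b.cost + 1) * (n * n) := Nat.le_mul_of_pos_right _ h2
          rw [add_assoc, ← hb]
          exact add_le_add (Nat.mul_le_mul_left _ (by omega)) h3
      _ = _ := by ring
  · rintro s' ⟨⟨i, hi⟩, hb'⟩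
    have hin := mt (hbI i s' hi).2 hb'
    obtain ⟨-, h0, hr, ha, h3, h4, h5, h6⟩ := hi
    obtain rfl : i = 2 * n := by omega
    exact ⟨hr, ha, h3, h4, h5, h6⟩

/-- The price increment used for weights of range `D`. -/
def increment (n : ℕ) (ε D : ℝ) : ℝ := if D ≤ 0 then 1 else ε * D / (2 * n)

theorem start_halts {n : ℕ} {ε : ℝ} {cx cy tx ty : ℕ → ℝ} {s : State}
    (hs : Ready n ε cx cy tx ty s) :
    start.HaltsWithin s start.cost (fun s' => (∀ a ≠ 6, s'.real a = s.real a) ∧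
      (∀ a ≠ 3, s'.nat a = s.nat a) ∧ s'.nat 3 0 = s.nat 3 0 ∧ s'.nat 3 1 = 0 ∧
      s'.real 6 1 = increment n ε (s.real 6 0)) := by
  refine Program.LoopFree.haltsWithin (by simp [start, Program.LoopFree]) ?_
  simp only [start, Program.exec, Test.Holds, RealExpr.eval, NatExpr.eval, State.setNat,
    State.setReal, increment, Nat.cast_zero]
  split_ifs with h
  · simp +contextual
  · simp +contextual [hs.n_eq, hs.eps_eq, two_mul]

/-- The iterations are counted by the number of bids. While the loop runs, some object is free and
has no bids, and the others have at most `B` each, so there have been fewer than 2nB bids. -/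
theorem bidding_halts : ∃ C : ℕ, ∀ (n B : ℕ) (ε δ : ℝ) (cx cy tx ty : ℕ → ℝ) (s : State), 1 ≤ n →
    0 < δ → (∀ p < 2 * n, ∀ i < 2 * n, ∀ j < 2 * n,
      slotWeight cx cy tx ty p i - slotWeight cx cy tx ty p j < B * δ) →
    Ready n ε cx cy tx ty s → s.nat 3 0 = 0 → s.nat 3 1 = 0 → s.nat 2 = 0 → s.real 5 = 0 →
    s.real 6 1 = δ →
    bidding.HaltsWithin s (C * n * n * (B + 1)) (fun s' => ∃ (ow b : ℕ → ℕ) (t : ℕ),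
      AuctionInv (2 * n) B (slotWeight cx cy tx ty) δ (2 * n) (2 * n) (s'.nat 1) ow b t) := by
  obtain ⟨C, hC⟩ := scan_halts
  set b : Test := .not (.natLE slotsE mE) with hb
  refine ⟨2 * (b.cost + (C + assign.cost) + 1) + (b.cost + 1),
    fun n B ε δ cx cy tx ty s hn hδ hB hs hm hcur h2 h5 h6 => ?_⟩
  set w := slotWeight cx cy tx ty with hw
  let Inv : ℕ → State → Prop := fun i s' => Ready n ε cx cy tx ty s' ∧ s'.real 6 1 = δ ∧
    ∃ k : ℕ → ℕ, (∀ j < 2 * n, s'.real 5 j = k j * δ) ∧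
      AuctionInv (2 * n) B w δ (s'.nat 3 0) (s'.nat 3 1) (s'.nat 1) (s'.nat 2) k i
  have hbI : ∀ i s', Inv i s' → (b.Holds s' ↔ s'.nat 3 0 < 2 * n) := by
    rintro i s' ⟨h1, -⟩
    simp [hb, Test.Holds, NatExpr.eval, h1.n_eq, two_mul]
  refine (Program.HaltsWithin.loop (T := C * n + assign.cost) (M := 2 * n * B) Inv
    ?_ ?_ ?_).mono ?_ ?_
  · rintro i s' hi hb'
    have hin := (hbI i s' hi).1 hb'
    obtain ⟨-, -, k, -, h⟩ := hi
    obtain ⟨j, hj, hfree⟩ := h.exists_free hin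
    have h0 := h.free j hj hfree
    have hBpos : 0 < B := by
      have := hB 0 (by omega) 0 (by omega) 0 (by omega)
      rw [sub_self] at this
      exact_mod_cast (pos_iff_pos_of_mul_pos this).2 hδ
    rw [← h.sum_eq]
    calc ∑ j ∈ Finset.range (2 * n), k j < ∑ j ∈ Finset.range (2 * n), B :=
          Finset.sum_lt_sum (fun j hj => h.bids_le j (Finset.mem_range.1 hj))
            ⟨j, Finset.mem_range.2 hj, by omega⟩
      _ = _ := by simp
  · intro i s' hi hb'
    have hin := (hbI i s' hi).1 hb'
    obtain ⟨hs', hinc, k, hk, h⟩ := hi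
    refine (hC n ε cx cy tx ty s' hn hs' (h.cur_lt hin)).seq ?_
    rintro t ⟨tr, ta, t3, tb, tmax⟩
    have ht : Ready n ε cx cy tx ty t := hs'.congr
      (fun a h => ta a (by omega)) (fun a _ => by rw [tr])
    have hc : t.nat 3 1 = s'.nat 3 1 := t3 1 (by omega) (by omega)
    have hm : t.nat 3 0 = s'.nat 3 0 := t3 0 (by omega) (by omega)
    have hstep := h.step hin hδ hB tb (fun j hj => by
      rw [← hk j hj, ← hk _ tb]; exact tmax j hj)
    refine Program.LoopFree.haltsWithin (by simp [assign, Program.LoopFree]) ?_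
    set j := t.nat 3 3 with hj
    have e1 : (assign.exec t).nat 1 = Function.update (s'.nat 1) (s'.nat 3 1) j := by
      simp only [assign, Program.exec, Test.Holds, NatExpr.eval, State.setNat, State.setReal]
      simp [hc, ← hj, ta]
      split_ifs <;> simp
    have e2 : (assign.exec t).nat 2 = Function.update (s'.nat 2) j (s'.nat 3 1 + 1) := by
      simp only [assign, Program.exec, Test.Holds, NatExpr.eval, State.setNat, State.setReal]
      simp [hc, ← hj, ta]
      split_ifs <;> simp
    have e3 : (assign.exec t).nat 3 0 = if s'.nat 2 j = 0 then s'.nat 3 0 + 1 else s'.nat 3 0 := by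
      simp only [assign, Program.exec, Test.Holds, NatExpr.eval, State.setNat, State.setReal]
      simp [hm, ← hj, ta]
      split_ifs <;> simp [hm]
    have e4 : (assign.exec t).nat 3 1 =
        if s'.nat 2 j = 0 then s'.nat 3 0 + 1 else s'.nat 2 j - 1 := by
      simp only [assign, Program.exec, Test.Holds, NatExpr.eval, State.setNat, State.setReal]
      simp [hm, ← hj, ta]
      split_ifs <;> simp
    have e5 : (assign.exec t).real = Function.update t.real 5
        (Function.update (t.real 5) j (t.real 5 j + t.real 6 1)) := by
      simp only [assign, Program.exec, Test.Holds, NatExpr.eval, State.setNat, State.setReal,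
        RealExpr.eval]
      simp [← hj]
      split_ifs <;> rfl
    have e6 : ∀ a, a = 0 ∨ a = 4 ∨ a = 5 → (assign.exec t).nat a = t.nat a := by
      intro a ha
      simp only [assign, Program.exec, Test.Holds, NatExpr.eval, State.setNat, State.setReal]
      rcases ha with rfl | rfl | rfl <;> simp <;> split_ifs <;> simp
    refine ⟨ht.congr e6 (fun a ha => ?_), ?_, Function.update k j (k j + 1), ?_, ?_⟩
    · rw [e5, Function.update_of_ne (by omega)]
    · rw [e5, Function.update_of_ne (by omega), tr, hinc]
    · intro i hi
      rw [e5, Function.update_self, tr]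
      rcases eq_or_ne i j with rfl | hij
      · simp [hk _ hi, hinc]; ring
      · simp [hij, hk i hi]
    · rw [e1, e2, e3, e4]; exact hstep
  · refine ⟨hs, h6, 0, by simp [h5], ?_⟩
    rw [hm, hcur, h2]
    exact ⟨le_rfl, by omega, id, by omega, by simp, by simp, by simp, by simp,
      fun p _ h h' => absurd (Nat.le_zero.1 h) h', fun p _ h h' => absurd (Nat.le_zero.1 h) h'⟩
  · have : C * n + assign.cost ≤ (C + assign.cost) * n := by nlinarith
    calc _ ≤ 2 * n * B * (b.cost * n + (C + assign.cost) * n + n) +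
            (b.cost + 1) * (n * n * (B + 1)) := by
          have h1 : b.cost ≤ b.cost * n := Nat.le_mul_of_pos_right _ hn
          have h2 : 1 ≤ n * n * (B + 1) := Nat.mul_pos (Nat.mul_pos hn hn) (by omega)
          have h3 : b.cost + 1 ≤ (b.cost + 1) * (n * n * (B + 1)) := Nat.le_mul_of_pos_right _ h2
          rw [add_assoc, ← hb]
          exact add_le_add (Nat.mul_le_mul_left _ (by omega)) h3
      _ ≤ _ := by
          have : 0 ≤ n * n * (b.cost + (C + assign.cost) + 1) := Nat.zero_le _
          nlinarith
  · rintro s' ⟨⟨i, hi⟩, hb'⟩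
    have hin := mt (hbI i s' hi).2 hb'
    obtain ⟨-, -, k, -, h⟩ := hi
    have hm := h.le_card
    have hm' : s'.nat 3 0 = 2 * n := by omega
    have hc' := h.cur_eq hm'
    rw [hm', hc'] at h
    exact ⟨_, _, _, h⟩

end Auction
end MaxSumOfAngles
end

/-! ### Bounds on the weights, and the whole program. -/

noncomputable section
namespace MaxSumOfAngles
open RealRAM

theorem slotWeight_even (cx cy tx ty : ℕ → ℝ) (k c : ℕ) :
    slotWeight cx cy tx ty (2 * k) c = -viewAngle cx cy tx ty k c := by
  simp [slotWeight]

theorem slotWeight_odd (cx cy tx ty : ℕ → ℝ) (k c : ℕ) :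
    slotWeight cx cy tx ty (2 * k + 1) c = viewAngle cx cy tx ty k c := by
  have h1 : (2 * k + 1) % 2 = 1 := by omega
  have h2 : (2 * k + 1) / 2 = k := by omega
  rw [slotWeight, h1, h2]
  norm_num

namespace Auction

variable {n : ℕ} {ε : ℝ} {cx cy tx ty : ℕ → ℝ}

/-- The two slots of a target carry opposite signs, so one-sided bounds on both give a two-sided
bound. -/
theorem IsRange.abs_viewAngle_sub_le {D : ℝ} (h : IsRange (2 * n) (slotWeight cx cy tx ty) D)
    {k c : ℕ} (hk : k < n) (hc : c < 2 * n) :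
    |viewAngle cx cy tx ty k c - viewAngle cx cy tx ty k 0| ≤ D := by
  have h0 := h.le (2 * k) (by omega) c hc
  have h1 := h.le (2 * k + 1) (by omega) c hc
  rw [slotWeight_even, slotWeight_even] at h0
  rw [slotWeight_odd, slotWeight_odd] at h1
  rw [abs_le]
  constructor <;> linarith

theorem abs_slotWeight_sub (p c c' : ℕ) :
    |slotWeight cx cy tx ty p c - slotWeight cx cy tx ty p c'| =
      |viewAngle cx cy tx ty (p / 2) c - viewAngle cx cy tx ty (p / 2) c'| := by
  rw [slotWeight, slotWeight, ← mul_sub, abs_mul]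
  rcases Nat.mod_two_eq_zero_or_one p with h | h <;> rw [h] <;> norm_num

theorem IsRange.slotWeight_sub_le {D : ℝ} (h : IsRange (2 * n) (slotWeight cx cy tx ty) D)
    {p i j : ℕ} (hp : p < 2 * n) (hi : i < 2 * n) (hj : j < 2 * n) :
    slotWeight cx cy tx ty p i - slotWeight cx cy tx ty p j ≤ 2 * D := by
  have h1 := h.abs_viewAngle_sub_le (k := p / 2) (by omega) hi
  have h2 := h.abs_viewAngle_sub_le (k := p / 2) (by omega) hj
  rw [← abs_slotWeight_sub] at h1 h2
  linarith [(abs_le.1 h1).2, (abs_le.1 h2).1]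

theorem increment_pos {n : ℕ} {ε D : ℝ} (hn : 0 < n) (hε : 0 < ε) : 0 < increment n ε D := by
  unfold increment
  split_ifs with h
  · exact one_pos
  · have := not_le.1 h
    positivity

theorem main_halts_of_le_one {s : State} (hs : s.nat 0 0 ≤ 1) (h1 : s.nat 1 = 0) :
    main.HaltsWithin s ((Test.natLE nE (.const 1)).cost +
      (Program.natSet 1 (.const 1) (.const 1)).cost + 1)
      (fun s' => s'.nat 1 0 = 0 ∧ s'.nat 1 1 = 1) := by
  have h : (Test.natLE nE (.const 1)).Holds s := by simpa [Test.Holds, NatExpr.eval] using hs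
  refine ⟨_, _, .iteTrue h (.natSet _ _ _ _), le_rfl, ?_⟩
  simp [State.setNat, NatExpr.eval, h1]

theorem main_halts : ∃ C : ℕ, ∀ (n B : ℕ) (ε : ℝ) (cx cy tx ty : ℕ → ℝ) (s : State), 2 ≤ n →
    0 < ε → 4 * n / ε < B → HasInput n ε cx cy tx ty s → (∀ a ≠ 0, s.nat a = 0) →
    s.real 5 = 0 → s.real 6 = 0 →
    main.HaltsWithin s (C * n * n * (B + 1)) (fun s' => ∃ (D : ℝ) (ow b : ℕ → ℕ) (t : ℕ),
      IsRange (2 * n) (slotWeight cx cy tx ty) D ∧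
      AuctionInv (2 * n) B (slotWeight cx cy tx ty) (increment n ε D) (2 * n) (2 * n) (s'.nat 1)
        ow b t) := by
  obtain ⟨C₁, h₁⟩ := setup_halts
  obtain ⟨C₂, h₂⟩ := measure_halts
  obtain ⟨C₃, h₃⟩ := bidding_halts
  set c := (Test.natLE nE (.const 1)).cost + 1 with hc
  refine ⟨C₁ + C₂ + start.cost + C₃ + c, fun n B ε cx cy tx ty s hn hε hB hs hnat hr5 hr6 => ?_⟩
  have hb : ¬ (Test.natLE nE (.const 1)).Holds s := by
    simp only [Test.Holds, NatExpr.eval, hs.n_eq]; omega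
  suffices H : (Program.seq setup (.seq measure (.seq start bidding))).HaltsWithin s
      (C₁ * n + (C₂ * n * n + (start.cost + C₃ * n * n * (B + 1)))) (fun s' =>
        ∃ (D : ℝ) (ow b : ℕ → ℕ) (t : ℕ), IsRange (2 * n) (slotWeight cx cy tx ty) D ∧
        AuctionInv (2 * n) B (slotWeight cx cy tx ty) (increment n ε D) (2 * n) (2 * n) (s'.nat 1)
        ow b t) by
    obtain ⟨τ, s', hr, hτ, hQ⟩ := H
    refine ⟨_, s', .iteFalse hb hr, ?_, hQ⟩
    have e1 : 1 ≤ n * n * (B + 1) := Nat.mul_pos (Nat.mul_pos (by omega) (by omega)) (by omega)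
    have e2 : n ≤ n * n * (B + 1) := by
      rw [mul_assoc]; exact Nat.le_mul_of_pos_right _ (Nat.mul_pos (by omega) (by omega))
    have e3 : n * n ≤ n * n * (B + 1) := Nat.le_mul_of_pos_right _ (by omega)
    have f1 := Nat.mul_le_mul_left (start.cost + c) e1
    have f2 := Nat.mul_le_mul_left C₁ e2
    have f3 := Nat.mul_le_mul_left C₂ e3
    calc _ = τ + c := by rw [hc]; ring
      _ ≤ _ := by nlinarith
  refine (h₁ n ε cx cy tx ty s (by omega) hs (by simp [hnat]) (hnat 5 (by simp))).seq ?_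
  rintro s₁ ⟨ready₁, real₁, nat₁, nat₁'⟩
  refine (h₂ n ε cx cy tx ty s₁ (by omega) ready₁ (by simp [nat₁' 1, hnat]) (by rw [real₁, hr5])
    (by rw [real₁, hr6]; rfl)).seq ?_
  rintro s₂ ⟨real₂, nat₂, cell₂, range₂⟩
  have ready₂ := ready₁.congr (s' := s₂) (fun a ha => nat₂ a (by omega))
    (fun a ha => real₂ a (by omega))
  refine (start_halts ready₂).seq ?_
  rintro s₃ ⟨real₃, nat₃, cell₃, cur₃, inc₃⟩
  have ready₃ := ready₂.congr (s' := s₃) (fun a ha => nat₃ a (by omega))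
    (fun a ha => real₃ a (by omega))
  refine (h₃ n B ε (increment n ε (s₂.real 6 0)) cx cy tx ty s₃ (by omega)
    (increment_pos (by omega) hε) ?_ ready₃ ?_ cur₃ ?_ ?_ inc₃).mono le_rfl ?_
  · intro p hp i hi j hj
    -- Weights of one slot differ by at most 2D (compare both with camera 0), and 2D divided by
    -- εD/(2n) is 4n/ε, the lower bound on `B`.
    refine (range₂.slotWeight_sub_le hp hi hj).trans_lt ?_
    have hB0 : (0 : ℝ) < B := lt_of_le_of_lt (by positivity) hB
    unfold increment
    split_ifs with hD
    · linarith
    · have hD := not_le.1 hD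
      have hn0 : (0 : ℝ) < n := by exact_mod_cast (by omega : 0 < n)
      rw [div_lt_iff₀ hε] at hB
      rw [mul_div_assoc', lt_div_iff₀ (by positivity)]
      nlinarith
  · rw [cell₃, cell₂, nat₁' 0 (by omega), hnat 3 (by simp)]; rfl
  · rw [nat₃ 2 (by omega), nat₂ 2 (by omega), nat₁ 2 (by omega), hnat 2 (by simp)]
  · rw [real₃ 5 (by omega), real₂ 5 (by omega), real₁, hr5]
  · rintro s' ⟨ow, b, t, h⟩
    exact ⟨_, ow, b, t, range₂, h⟩

end Auction
end MaxSumOfAngles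
end

/-! ### Tracking angles as differences of arctangents. -/

namespace MaxSumOfAngles

/-- The argument is the cosine of the difference by the addition formula, and the absolute
difference of two arctangents lies in [0, π], where `arccos` inverts `cos`. -/
theorem arccos_eq_abs_arctan_sub (x y : ℝ) :
    Real.arccos ((1 + x * y) / (√(1 + x ^ 2) * √(1 + y ^ 2))) =
      |Real.arctan x - Real.arctan y| := by
  have h : (1 + x * y) / (√(1 + x ^ 2) * √(1 + y ^ 2)) =
      Real.cos |Real.arctan x - Real.arctan y| := by
    rw [Real.cos_abs, Real.cos_sub, Real.cos_arctan, Real.cos_arctan, Real.sin_arctan,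
      Real.sin_arctan]
    have h1 : 0 < √(1 + x ^ 2) := by positivity
    have h2 : 0 < √(1 + y ^ 2) := by positivity
    field_simp
  rw [h, Real.arccos_cos (abs_nonneg _)]
  rw [abs_le]
  have := Real.arctan_lt_pi_div_two x
  have := Real.arctan_lt_pi_div_two y
  have := Real.neg_pi_div_two_lt_arctan x
  have := Real.neg_pi_div_two_lt_arctan y
  constructor <;> linarith

/-- Here `u` is the direction of the line, and equal cross products with `u` say that the tips of
`v` and `w` lie on one parallel to it. Dot product over cross product is the tangent of the angle
from the perpendicular. Norms and inner product follow from Lagrange's identity (v·u)² + h² =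
|v|²|u|² and its polarization. -/
theorem angle_eq_abs_arctan_sub {v w u : EuclideanSpace ℝ (Fin 2)} {h : ℝ} (hh : h ≠ 0)
    (hv : v 0 * u 1 - v 1 * u 0 = h) (hw : w 0 * u 1 - w 1 * u 0 = h) :
    InnerProductGeometry.angle v w =
      |Real.arctan ((v 0 * u 0 + v 1 * u 1) / h) - Real.arctan ((w 0 * u 0 + w 1 * u 1) / h)| := by
  rw [← arccos_eq_abs_arctan_sub, InnerProductGeometry.angle]
  congr 1
  set a := v 0 * u 0 + v 1 * u 1 with ha
  set b := w 0 * u 0 + w 1 * u 1 with hb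
  set U := u 0 ^ 2 + u 1 ^ 2 with hU
  have hU0 : 0 < U := by
    rcases eq_or_ne (u 0) 0 with h0 | h0
    · have : u 1 ≠ 0 := by rintro h1; rw [h0, h1] at hv; apply hh; linarith
      positivity
    · positivity
  have hva : (v 0 ^ 2 + v 1 ^ 2) = h ^ 2 / U * (1 + (a / h) ^ 2) := by
    field_simp
    rw [ha, hU, ← hv]; ring
  have hwb : (w 0 ^ 2 + w 1 ^ 2) = h ^ 2 / U * (1 + (b / h) ^ 2) := by
    field_simp
    rw [hb, hU, ← hw]; ring
  have hvw : inner ℝ v w = h ^ 2 / U * (1 + a / h * (b / h)) := by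
    have : inner ℝ v w = v 0 * w 0 + v 1 * w 1 := by
      simp [PiLp.inner_apply, Fin.sum_univ_two]; ring
    rw [this]
    have e : h ^ 2 = (v 0 * u 1 - v 1 * u 0) * (w 0 * u 1 - w 1 * u 0) := by rw [hv, hw, sq]
    field_simp
    rw [e, hU, ha, hb]; ring
  have hc : 0 < h ^ 2 / U := by positivity
  rw [hvw, EuclideanSpace.norm_eq, EuclideanSpace.norm_eq]
  simp only [Fin.sum_univ_two, Real.norm_eq_abs, sq_abs]
  rw [hva, hwb, Real.sqrt_mul hc.le, Real.sqrt_mul hc.le]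
  have h1 : 0 < √(1 + (a / h) ^ 2) := by positivity
  have h2 : 0 < √(1 + (b / h) ^ 2) := by positivity
  have h3 : √(h ^ 2 / U) * √(h ^ 2 / U) = h ^ 2 / U := Real.mul_self_sqrt hc.le
  rw [mul_mul_mul_comm, h3, mul_div_mul_left _ _ hc.ne']

/-- Nonzero vectors parallel to `u` at an angle of at most `π / 2` point in the same direction. -/
theorem angle_eq_zero_of_parallel {v w u : EuclideanSpace ℝ (Fin 2)} (hu : u ≠ 0)
    (hv0 : v ≠ 0) (hw0 : w ≠ 0)
    (hv : v 0 * u 1 - v 1 * u 0 = 0) (hw : w 0 * u 1 - w 1 * u 0 = 0)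
    (hle : InnerProductGeometry.angle v w ≤ Real.pi / 2) :
    InnerProductGeometry.angle v w = 0 := by
  have key : ∀ x : EuclideanSpace ℝ (Fin 2), x 0 * u 1 - x 1 * u 0 = 0 → ∃ r : ℝ, x = r • u := by
    intro x hx
    by_cases h0 : u 0 = 0
    · have h1 : u 1 ≠ 0 := by
        intro h1; apply hu; ext i; fin_cases i <;> simp [h0, h1]
      refine ⟨x 1 / u 1, ?_⟩
      ext i
      fin_cases i
      · simp only [h0, mul_zero, sub_zero, mul_eq_zero, h1, or_false] at hx
        simp [h0, hx]
      · simp [h1]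
    · refine ⟨x 0 / u 0, ?_⟩
      ext i
      fin_cases i
      · simp [h0]
      · simp only [Fin.mk_one, PiLp.smul_apply, smul_eq_mul]
        field_simp
        linarith
  obtain ⟨r, rfl⟩ := key v hv
  obtain ⟨q, rfl⟩ := key w hw
  have hr : r ≠ 0 := by rintro rfl; simp at hv0
  have hq : q ≠ 0 := by rintro rfl; simp at hw0
  have hpi := Real.pi_pos
  rcases lt_or_gt_of_ne hr with hr | hr <;> rcases lt_or_gt_of_ne hq with hq | hq
  · simp [InnerProductGeometry.angle_smul_left_of_neg, InnerProductGeometry.angle_smul_right_of_neg,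
      hr, hq, InnerProductGeometry.angle_self hu]
  · simp [InnerProductGeometry.angle_smul_left_of_neg, InnerProductGeometry.angle_smul_right_of_pos,
      hr, hq, InnerProductGeometry.angle_self hu, InnerProductGeometry.angle_neg_left] at hle
    linarith
  · simp [InnerProductGeometry.angle_smul_left_of_pos, InnerProductGeometry.angle_smul_right_of_neg,
      hr, hq, InnerProductGeometry.angle_self hu, InnerProductGeometry.angle_neg_right] at hle
    linarith
  · simp [InnerProductGeometry.angle_smul_left_of_pos, InnerProductGeometry.angle_smul_right_of_pos,
      hr, hq, InnerProductGeometry.angle_self hu]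

end MaxSumOfAngles

/-! ### Assignments as bijections from slots to cameras, and the approximation guarantee. -/

noncomputable section
namespace MaxSumOfAngles
open RealRAM

variable {n : ℕ}

/-- The slots of the targets, `2 * k` and `2 * k + 1` for the target `k`. -/
def slotEquiv (n : ℕ) : Fin n × Fin 2 ≃ Fin (2 * n) :=
  finProdFinEquiv.trans (finCongr (mul_comm n 2))

theorem slotEquiv_val (k : Fin n) (j : Fin 2) :
    (slotEquiv n (k, j) : ℕ) = 2 * (k : ℕ) + (j : ℕ) := by
  simp [slotEquiv, add_comm]

/-- The assignment that fills the slots by a bijection. -/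
def Assignment.ofEquiv (e : Fin n × Fin 2 ≃ Fin (2 * n)) : Assignment n where
  cam k j := e (k, j)
  existsUnique := e.bijective.existsUnique

/-- The bijection from slots to cameras of an assignment. -/
def Assignment.toEquiv (A : Assignment n) : Fin n × Fin 2 ≃ Fin (2 * n) :=
  Equiv.ofBijective (fun p => A.cam p.1 p.2)
    ((Function.bijective_iff_existsUnique _).2 A.existsUnique)

theorem Assignment.cam_ne (A : Assignment n) (k : Fin n) : A.cam k 0 ≠ A.cam k 1 := by
  intro h
  have := A.toEquiv.injective (a₁ := (k, 0)) (a₂ := (k, 1)) h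
  simp at this

/-- Two transpositions suffice: one brings `i` into the first slot, the next brings `j` into the
second without moving `i`. This makes any single angle a lower bound for the optimum. -/
theorem exists_assignment_cam_eq (k : Fin n) {i j : Fin (2 * n)} (hij : i ≠ j) :
    ∃ A : Assignment n, A.cam k 0 = i ∧ A.cam k 1 = j := by
  set a := slotEquiv n (k, 0) with ha
  set b := slotEquiv n (k, 1) with hb
  have hab : a ≠ b := by simp [ha, hb]
  have hib : i ≠ Equiv.swap a i b := by
    intro h
    apply hab
    apply (Equiv.swap a i).injective
    rw [Equiv.swap_apply_left]
    exact h
  refine ⟨.ofEquiv (((slotEquiv n).trans (Equiv.swap a i)).trans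
    (Equiv.swap (Equiv.swap a i b) j)), ?_, ?_⟩
  · change Equiv.swap (Equiv.swap a i b) j (Equiv.swap a i a) = i
    rw [Equiv.swap_apply_left, Equiv.swap_apply_of_ne_of_ne hib hij]
  · change Equiv.swap (Equiv.swap a i b) j (Equiv.swap a i b) = j
    rw [Equiv.swap_apply_left]

theorem sum_range_eq_sum_slots (w : ℕ → ℕ → ℝ) (e : Fin n × Fin 2 ≃ Fin (2 * n)) {g : ℕ → ℕ}
    (hg : ∀ (k : Fin n) (j : Fin 2), g (2 * (k : ℕ) + (j : ℕ)) = e (k, j)) :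
    ∑ p ∈ Finset.range (2 * n), w p (g p) =
      ∑ k : Fin n, (w (2 * k) (e (k, 0)) + w (2 * k + 1) (e (k, 1))) := by
  rw [Finset.sum_range, ← (slotEquiv n).sum_comp, Fintype.sum_prod_type]
  refine Finset.sum_congr rfl fun k _ => ?_
  rw [Fin.sum_univ_two, slotEquiv_val, slotEquiv_val, hg, hg]
  rfl

/-- The bijection from slots to cameras, on natural numbers. -/
def slotFun (e : Fin n × Fin 2 ≃ Fin (2 * n)) (p : ℕ) : ℕ :=
  if h : p < 2 * n then e ((slotEquiv n).symm ⟨p, h⟩) else 0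

theorem slotFun_slot (e : Fin n × Fin 2 ≃ Fin (2 * n)) (k : Fin n) (j : Fin 2) :
    slotFun e (2 * (k : ℕ) + (j : ℕ)) = e (k, j) := by
  have h : 2 * (k : ℕ) + (j : ℕ) < 2 * n := by omega
  have : (⟨2 * (k : ℕ) + (j : ℕ), h⟩ : Fin (2 * n)) = slotEquiv n (k, j) :=
    Fin.ext (slotEquiv_val k j).symm
  rw [slotFun, dif_pos h, this, Equiv.symm_apply_apply]

theorem slotFun_lt (e : Fin n × Fin 2 ≃ Fin (2 * n)) (p : ℕ) (hp : p < 2 * n) :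
    slotFun e p < 2 * n := by
  rw [slotFun, dif_pos hp]; exact Fin.isLt _

theorem slotFun_injOn (e : Fin n × Fin 2 ≃ Fin (2 * n)) :
    Set.InjOn (slotFun e) (Set.Iio (2 * n)) := by
  intro p hp q hq h
  rw [Set.mem_Iio] at hp hq
  rw [slotFun, slotFun, dif_pos hp, dif_pos hq] at h
  simpa using (slotEquiv n).symm.injective (e.injective (Fin.ext h))

theorem exists_equiv_of_injOn {g : ℕ → ℕ} (hg : ∀ p < 2 * n, g p < 2 * n)
    (hinj : Set.InjOn g (Set.Iio (2 * n))) :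
    ∃ e : Fin n × Fin 2 ≃ Fin (2 * n), ∀ (k : Fin n) (j : Fin 2), g (2 * (k : ℕ) + (j : ℕ)) = e (k, j) := by
  have hf : Function.Injective (fun p : Fin (2 * n) => (⟨g p, hg p p.2⟩ : Fin (2 * n))) := by
    intro p q h
    exact Fin.ext (hinj p.2 q.2 (congrArg Fin.val h))
  refine ⟨(slotEquiv n).trans (Equiv.ofBijective _ (Finite.injective_iff_bijective.1 hf)),
    fun k j => ?_⟩
  simp [slotEquiv_val]

namespace Input

/-- The view angle of the camera `c` at the target `k` in the coordinates of the input. -/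
def viewAngle (I : Input n) (k c : ℕ) : ℝ :=
  -- The value of ε affects only real array 0, so 0 serves here.
  let s := I.initialState 0
  MaxSumOfAngles.viewAngle (s.real 1) (s.real 2) (s.real 3) (s.real 4) k c

/-- The slot weights in the coordinates of the input. -/
def slotWeight (I : Input n) : ℕ → ℕ → ℝ :=
  let s := I.initialState 0
  MaxSumOfAngles.slotWeight (s.real 1) (s.real 2) (s.real 3) (s.real 4)

theorem angle_eq (I : Input n) (k : Fin n) {i j : Fin (2 * n)} (hij : i ≠ j) :
    ∠ (I.cam i) (I.tgt k) (I.cam j) = |I.viewAngle k i - I.viewAngle k j| := by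
  have hn : 1 < 2 * n := by have := k.2; omega
  set c₀ := I.cam ⟨0, by omega⟩ with hc₀
  set u := I.cam ⟨1, hn⟩ - c₀ with hu
  have hu0 : u ≠ 0 := by
    rw [hu, sub_ne_zero]
    intro h
    simpa using I.cam_injective h
  obtain ⟨v, hv⟩ := (collinear_iff_of_mem (Set.mem_range_self ⟨0, by omega⟩)).1 I.cam_collinear
  have hcross : ∀ i, (I.cam i - c₀) 0 * u 1 - (I.cam i - c₀) 1 * u 0 = 0 := by
    intro i
    obtain ⟨r, hr⟩ := hv _ (Set.mem_range_self i)
    obtain ⟨q, hq⟩ := hv _ (Set.mem_range_self ⟨1, hn⟩)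
    rw [hu, hr, hq, hc₀]
    simp
    ring
  set h := (c₀ - I.tgt k) 0 * u 1 - (c₀ - I.tgt k) 1 * u 0 with hh
  have hside : ∀ i, (I.cam i - I.tgt k) 0 * u 1 - (I.cam i - I.tgt k) 1 * u 0 = h := by
    intro i
    have := hcross i
    simp only [PiLp.sub_apply] at this hh ⊢
    rw [hh]
    linarith
  have hview : ∀ i : Fin (2 * n), I.viewAngle k i = Real.arctan
      (((I.cam i - I.tgt k) 0 * u 0 + (I.cam i - I.tgt k) 1 * u 1) / h) := by
    intro i
    rw [← hside i]
    have hn0 : 0 < 2 * n := by omega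
    simp [Input.viewAngle, MaxSumOfAngles.viewAngle, Input.initialState, hn, hn0, hu, hc₀]
  have hangle : ∠ (I.cam i) (I.tgt k) (I.cam j) =
      InnerProductGeometry.angle (I.cam i - I.tgt k) (I.cam j - I.tgt k) := rfl
  rcases eq_or_ne h 0 with h0 | h0
  -- The target is on the camera line. Division by 0 makes every view angle 0, which is right
  -- because the right-angle condition excludes a target between two cameras.
  · rw [hview, hview, h0, div_zero, div_zero, sub_self, abs_zero, hangle]
    exact angle_eq_zero_of_parallel hu0 (sub_ne_zero.2 (I.tgt_ne_cam k i).symm)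
      (sub_ne_zero.2 (I.tgt_ne_cam k j).symm) ((hside i).trans h0) ((hside j).trans h0)
      (hangle ▸ I.angle_le k i j hij)
  · rw [hview, hview, hangle]
    exact angle_eq_abs_arctan_sub h0 (hside i) (hside j)

theorem sumOfAngles_eq (I : Input n) (A : Assignment n) :
    I.sumOfAngles A = ∑ k : Fin n, |I.viewAngle k (A.cam k 0) - I.viewAngle k (A.cam k 1)| :=
  Finset.sum_congr rfl fun k _ => I.angle_eq k (A.cam_ne k)

theorem sumOfAngles_nonneg (I : Input n) (A : Assignment n) : 0 ≤ I.sumOfAngles A := by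
  rw [sumOfAngles_eq]; exact Finset.sum_nonneg fun _ _ => abs_nonneg _

/-- A signed difference is at most its absolute value, so a matching that orders some pair wrongly
only underestimates its angles. -/
theorem sum_slotWeight_le (I : Input n) (e : Fin n × Fin 2 ≃ Fin (2 * n)) :
    ∑ k : Fin n, (I.slotWeight (2 * k) (e (k, 0)) + I.slotWeight (2 * k + 1) (e (k, 1))) ≤
      I.sumOfAngles (.ofEquiv e) := by
  rw [sumOfAngles_eq]
  refine Finset.sum_le_sum fun k _ => ?_
  rw [abs_sub_comm]
  refine le_trans (le_of_eq ?_) (le_abs_self _)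
  rw [slotWeight, slotWeight_even, slotWeight_odd, neg_add_eq_sub]
  rfl

theorem sumOfAngles_eq_of_one (I : Input 1) (A A' : Assignment 1) :
    I.sumOfAngles A = I.sumOfAngles A' := by
  have key : ∀ A : Assignment 1,
      I.sumOfAngles A = |I.viewAngle 0 0 - I.viewAngle 0 1| := by
    intro A
    have hne := A.cam_ne 0
    rw [sumOfAngles_eq, Fin.sum_univ_one]
    generalize A.cam 0 0 = i at hne ⊢
    generalize A.cam 0 1 = j at hne ⊢
    have hi := i.2
    have hj := j.2
    have hij : (i : ℕ) ≠ j := fun h => hne (Fin.ext h)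
    obtain ⟨h1, h2⟩ | ⟨h1, h2⟩ : ((i : ℕ) = 0 ∧ (j : ℕ) = 1) ∨ ((i : ℕ) = 1 ∧ (j : ℕ) = 0) := by
      omega
    · rw [h1, h2]; rfl
    · rw [h1, h2, abs_sub_comm]; rfl
  rw [key, key]

/-- Ordering the two cameras of each target turns the angles into sums of weights. -/
theorem exists_sum_slotWeight_eq (I : Input n) (A : Assignment n) :
    ∃ e : Fin n × Fin 2 ≃ Fin (2 * n), I.sumOfAngles A =
      ∑ k : Fin n, (I.slotWeight (2 * k) (e (k, 0)) + I.slotWeight (2 * k + 1) (e (k, 1))) := by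
  classical
  let f : Fin n → Fin 2 ≃ Fin 2 := fun k =>
    if I.viewAngle k (A.cam k 0) ≤ I.viewAngle k (A.cam k 1) then Equiv.refl _ else Equiv.swap 0 1
  refine ⟨(Equiv.prodShear (Equiv.refl _) f).trans A.toEquiv, ?_⟩
  rw [sumOfAngles_eq]
  refine Finset.sum_congr rfl fun k _ => ?_
  rw [slotWeight, slotWeight_even, slotWeight_odd, neg_add_eq_sub]
  change _ = I.viewAngle k (A.cam k (f k 1)) - I.viewAngle k (A.cam k (f k 0))
  by_cases h : I.viewAngle k (A.cam k 0) ≤ I.viewAngle k (A.cam k 1)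
  · simp only [f, h, if_true, Equiv.refl_apply]
    rw [abs_of_nonpos (sub_nonpos.2 h), neg_sub]
  · simp only [f, h, if_false, Equiv.swap_apply_left, Equiv.swap_apply_right]
    rw [abs_of_pos (sub_pos.2 (not_le.1 h))]

/-- The range of the weights is at most the value of some assignment. -/
theorem exists_range_le (I : Input n) {D : ℝ} (hn : 1 ≤ n)
    (hD : Auction.IsRange (2 * n) I.slotWeight D) : ∃ A : Assignment n, D ≤ I.sumOfAngles A := by
  obtain h0 | ⟨p, hp, c, hc, hpc⟩ := hD.attained
  · exact ⟨.ofEquiv (slotEquiv n), h0 ▸ I.sumOfAngles_nonneg _⟩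
  rcases eq_or_ne c 0 with rfl | hc0
  · rw [sub_self] at hpc
    exact ⟨.ofEquiv (slotEquiv n), hpc ▸ I.sumOfAngles_nonneg _⟩
  let k : Fin n := ⟨p / 2, by omega⟩
  obtain ⟨A, h1, h2⟩ := exists_assignment_cam_eq k (i := ⟨c, hc⟩) (j := ⟨0, by omega⟩)
    (by simpa using hc0)
  refine ⟨A, ?_⟩
  rw [sumOfAngles_eq]
  refine le_trans ?_ (Finset.single_le_sum (fun _ _ => abs_nonneg _) (Finset.mem_univ k))
  rw [h1, h2, hpc]
  exact (le_abs_self _).trans (Auction.abs_slotWeight_sub p c 0).le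

theorem sumOfAngles_eq_zero (I : Input n)
    (hD : Auction.IsRange (2 * n) I.slotWeight 0) (A : Assignment n) : I.sumOfAngles A = 0 := by
  rw [sumOfAngles_eq]
  refine Finset.sum_eq_zero fun k _ => ?_
  have key : ∀ c : Fin (2 * n), I.viewAngle k c = I.viewAngle k 0 := fun c =>
    sub_eq_zero.1 (abs_nonpos_iff.1 (hD.abs_viewAngle_sub_le k.2 c.2))
  rw [key, key, sub_self, abs_zero]

/-- The matching found by the auction is nearly optimal. -/
theorem exists_assignment_of_auctionInv (I : Input n) {B : ℕ} {ε D : ℝ} {mt ow b : ℕ → ℕ} {t : ℕ}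
    (hn : 1 ≤ n) (hε0 : 0 < ε) (hε : ε < 1) (hD : Auction.IsRange (2 * n) I.slotWeight D)
    (h : AuctionInv (2 * n) B I.slotWeight (Auction.increment n ε D) (2 * n) (2 * n) mt ow b t) :
    ∃ A : Assignment n, (∀ (k : Fin n) (j : Fin 2), mt (2 * (k : ℕ) + (j : ℕ)) = A.cam k j) ∧
      ∀ A' : Assignment n, (1 - ε) * I.sumOfAngles A' ≤ I.sumOfAngles A := by
  obtain ⟨e, he⟩ := exists_equiv_of_injOn h.injOn.1 h.injOn.2
  refine ⟨.ofEquiv e, he, fun A' => ?_⟩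
  rcases hD.nonneg.eq_or_lt with rfl | hpos
  · rw [I.sumOfAngles_eq_zero hD, I.sumOfAngles_eq_zero hD, mul_zero]
  have hn0 : (0 : ℝ) < n := by exact_mod_cast hn
  have hloss : ((2 * n : ℕ) : ℝ) * Auction.increment n ε D = ε * D := by
    rw [Auction.increment, if_neg (not_le.2 hpos)]
    push_cast
    field_simp
  have key : ∀ A' : Assignment n, I.sumOfAngles A' ≤ I.sumOfAngles (.ofEquiv e) + ε * D := by
    intro A'
    obtain ⟨e', he'⟩ := I.exists_sum_slotWeight_eq A'
    have := h.sum_le (slotFun_lt e') (slotFun_injOn e')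
    rw [hloss, sum_range_eq_sum_slots _ e' (slotFun_slot e'), sum_range_eq_sum_slots _ e he,
      ← he'] at this
    linarith [I.sum_slotWeight_le e]
  obtain ⟨A₀, hA₀⟩ := I.exists_range_le hn hD
  -- If `A'` has value at least D, the loss εD is at most ε times that value. Otherwise compare with
  -- `A₀`: the output has value at least (1 - ε)D, which exceeds what `A'` requires.
  rcases le_total D (I.sumOfAngles A') with hle | hle
  · have := key A'
    nlinarith
  · have := key A₀
    nlinarith

end Input

/-! ### The running time and the conclusion. -/

/-- The running time of the auction is within the claimed bound. -/
theorem time_le {C n B : ℕ} {ε : ℝ} (hn : 2 ≤ n) (hε : 0 < ε) (hε1 : ε < 1)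
    (hB : (B : ℝ) ≤ 4 * n / ε + 1) {K : ℝ} (hK : 6 * C + 12 ≤ K) :
    ((C * n * n * (B + 1) : ℕ) : ℝ) ≤
      K * (n : ℝ) ^ (K * (Real.log ((n : ℝ) / ε)) ^ 2 / ε ^ 4) := by
  have hn2 : (2 : ℝ) ≤ n := by exact_mod_cast hn
  have hC : (0 : ℝ) ≤ C := Nat.cast_nonneg C
  have hlog2 : (0.69 : ℝ) < Real.log 2 := by linarith [Real.log_two_gt_d9]
  have hdiv : (2 : ℝ) ≤ n / ε := by
    rw [le_div_iff₀ hε]; nlinarith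
  have hlog : 0.69 ≤ Real.log (n / ε) := hlog2.le.trans (Real.log_le_log two_pos hdiv)
  have hsq : 0.47 ≤ Real.log (n / ε) ^ 2 := by nlinarith
  -- The exponent 3 pays for n³ and 2/ε pays for the factor 1/ε, since n ≥ 2. The summand 12 in `K`
  -- suffices because 12 · 0.47 > 5.
  have hexp : 3 + 2 / ε ≤ K * Real.log (n / ε) ^ 2 / ε ^ 4 := by
    have h4 : ε ^ 4 ≤ ε := by
      calc ε ^ 4 ≤ ε ^ 1 := pow_le_pow_of_le_one hε.le hε1.le (by norm_num)
        _ = ε := pow_one ε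
    have h5 : 5 ≤ K * Real.log (n / ε) ^ 2 := by nlinarith
    calc 3 + 2 / ε ≤ 5 / ε := by
          rw [le_div_iff₀ hε, add_mul, div_mul_cancel₀ _ hε.ne']; linarith
      _ ≤ 5 / ε ^ 4 := div_le_div_of_nonneg_left (by norm_num) (by positivity) h4
      _ ≤ _ := by gcongr
  have hpow : (n : ℝ) ^ 3 * (1 / ε) ≤ (n : ℝ) ^ (K * Real.log (n / ε) ^ 2 / ε ^ 4) := by
    refine le_trans ?_ (Real.rpow_le_rpow_of_exponent_le (by linarith) hexp)
    rw [Real.rpow_add (by linarith)]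
    have h3 : (n : ℝ) ^ (3 : ℝ) = (n : ℝ) ^ 3 := by exact_mod_cast Real.rpow_natCast (n : ℝ) 3
    rw [h3]
    refine mul_le_mul_of_nonneg_left ?_ (by positivity)
    rw [Real.rpow_def_of_pos (by linarith)]
    have h1 : Real.log 2 ≤ Real.log n := Real.log_le_log two_pos hn2
    have h2 : 1 / ε ≤ Real.log n * (2 / ε) := by
      rw [mul_div_assoc', div_le_div_iff_of_pos_right hε]; linarith
    linarith [Real.add_one_le_exp (Real.log n * (2 / ε))]
  have hB' : (B : ℝ) + 1 ≤ 6 * n * (1 / ε) := by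
    have : 1 ≤ 1 / ε := by rw [le_div_iff₀ hε]; linarith
    have h4 : 4 * (n : ℝ) / ε = 4 * n * (1 / ε) := by ring
    rw [h4] at hB
    nlinarith
  push_cast
  calc (C : ℝ) * n * n * (B + 1) ≤ C * n * n * (6 * n * (1 / ε)) := by gcongr
    _ = 6 * C * ((n : ℝ) ^ 3 * (1 / ε)) := by ring
    _ ≤ K * (n : ℝ) ^ (K * Real.log (n / ε) ^ 2 / ε ^ 4) := by
        refine mul_le_mul (by linarith) hpow (by positivity) (by linarith)

end MaxSumOfAngles
end

theorem mainTheorem1 :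
    ∃ (P : RealRAM.Program) (K : ℝ),
      ∀ (n : ℕ), 1 ≤ n → ∀ (ε : ℝ), 0 < ε → ε < 1 → ∀ (I : MaxSumOfAngles.Input n),
        ∃ (τ : ℕ) (s : RealRAM.State) (A : MaxSumOfAngles.Assignment n),
          P.RunsIn (I.initialState ε) τ s ∧
          (τ : ℝ) ≤ K * (n : ℝ) ^ (K * (Real.log ((n : ℝ) / ε)) ^ 2 / ε ^ 4) ∧
          A.IsOutput s ∧
          ∀ A' : MaxSumOfAngles.Assignment n,
            (1 - ε) * I.sumOfAngles A' ≤ I.sumOfAngles A := by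
  open RealRAM MaxSumOfAngles in
  obtain ⟨C, hC⟩ := Auction.main_halts
  set c : ℕ := (Test.natLE Auction.nE (.const 1)).cost +
    (Program.natSet 1 (.const 1) (.const 1)).cost + 1 with hc
  -- The summand `c` covers n = 1, where the power of n equals 1; the rest is what `time_le` asks
  -- for.
  refine ⟨Auction.main, 6 * C + 12 + c, fun n hn ε hε hε1 I => ?_⟩
  rcases hn.eq_or_lt with rfl | hn2
  · obtain ⟨τ, s, hr, hτ, h0, h1⟩ := Auction.main_halts_of_le_one (s := I.initialState ε)
      (by simp [Input.initialState]) (by ext i; simp [Input.initialState])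
    refine ⟨τ, s, .ofEquiv (slotEquiv 1), hr, ?_, ?_, fun A' => ?_⟩
    · rw [Nat.cast_one, Real.one_rpow, mul_one]
      have : (τ : ℝ) ≤ c := by exact_mod_cast hτ
      have hC0 : (0 : ℝ) ≤ C := Nat.cast_nonneg C
      linarith
    · intro k j
      change _ = (slotEquiv 1 (k, j) : ℕ)
      rw [slotEquiv_val]
      fin_cases k; fin_cases j
      · simpa using h0
      · simpa using h1
    · rw [I.sumOfAngles_eq_of_one A' (.ofEquiv (slotEquiv 1))]
      nlinarith [I.sumOfAngles_nonneg (.ofEquiv (slotEquiv 1))]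
  · obtain ⟨τ, s, hr, hτ, D, ow, b, t, hD, h⟩ := hC n (⌊4 * n / ε⌋₊ + 1) ε _ _ _ _
      (I.initialState ε) hn2 hε (by push_cast; exact Nat.lt_floor_add_one _)
      ⟨by simp [Input.initialState], by simp [Input.initialState], rfl, rfl, rfl, rfl⟩
      (fun a ha => by ext i; simp [Input.initialState, ha]) rfl rfl
    obtain ⟨A, hA, hopt⟩ := I.exists_assignment_of_auctionInv hn hε hε1 hD h
    refine ⟨τ, s, A, hr, le_trans (Nat.cast_le.2 hτ) (time_le hn2 hε hε1 ?_ ?_), hA, hopt⟩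
    · push_cast
      gcongr
      exact Nat.floor_le (by positivity)
    · have : (0 : ℝ) ≤ c := Nat.cast_nonneg c
      linarith
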